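/- **Setting.** Let $T$ be a finite set of primitive tests, and let $\mathrm{Act}$ and $\mathrm{Out}$ be sets. Tests are $b,c ::= \mathbb 0\mid\mathbb 1\mid t\in T\mid\bar b\mid b+c\mid bc$; write $\equiv_{BA}$ for Boolean equivalence, $b\le c$ for $b+c\equiv_{BA}c$, and $\mathrm{At}$ for the set of atoms (minimal nonzero elements) of the algebra of tests modulo $\equiv_{BA}$. Let $\mathbb S$ be a semiring with $1\ne0$ that is *Conway* (it has an operation $^*$ with $(a+b)^*=a^*(ba^*)^*$ and $(ab)^*=1+a(ba)^*b$), *positive* ($x+y=0$ implies $x=y=0$) and *refinement* ($x+y=z+w$ implies that there are $s,t,u,v$ with $s+t=x$, $s+u=z$, $u+v=y$, $t+v=w$). The set $\mathrm{Exp}$ of expressions is given by $$e,f ::= p\in \mathrm{Act}\mid b\mid e+_bf\mid e;f\mid e^{(b)}\mid v\in \mathrm{Out}\mid e\,{}_r\!\oplus_s f\qquad(b \text{ a test},\ r,s\in\mathbb S),$$ and $\odot r:=\mathbb 1\,{}_r\!\oplus_0\mathbb 0$. **Bisimilarity.** For a set $Y$ let $\mathcal M_\omega(Y)$ be the set of finitely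 supported functions $\nu:Y\to\mathbb S$, and put $\nu[A]=\sum_{y\in A}\nu(y)$. An automaton is a set $X$ with a map $\beta:X\to\mathcal M_\omega(\{✓,✗\}+\mathrm{Out}+\mathrm{Act}\times X)^{\mathrm{At}}$. A homomorphism $(X,\beta)\to(Y,\gamma)$ is a map $h$ with $\gamma(h(x))_\alpha(o)=\beta(x)_\alpha(o)$ for $o\in\{✓,✗\}+\mathrm{Out}$ and $\gamma(h(x))_\alpha(p,y)=\beta(x)_\alpha[\{p\}\times h^{-1}(y)]$. A relation $R\subseteq X\times Y$ is a bisimulation if some automaton structure on $R$ makes both projections homomorphisms. The set $\mathrm{Exp}$ is an automaton with the transition function $\partial$ defined by recursion: $\partial(b)_\alpha$ is $\delta_✓$ if $\alpha\le b$ and $\delta_✗$ if $\alpha\le\bar b$; $\partial(v)_\alpha=\delta_v$; $\partial(p)_\alpha=\delta_{(p,\mathbb 1)}$; $\partial(e+_bf)_\alpha$ is $\partial(e)_\alpha$ if $\alpha\le b$ and $\partial(f)_\alpha$ if $\alpha\le\bar b$; $\partial(e\,{}_r\!\oplus_sf)_\alpha=r\,\partial(e)_\alpha+s\,\partial(f)_\alpha$;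 $\partial(e;f)_\alpha=\sum_x\partial(e)_\alpha(x)\,c(x)$ with $c(✓)=\partial(f)_\alpha$, $c(x)=\delta_x$ for $x\in\{✗\}\cup\mathrm{Out}$ and $c(p,e')=\delta_{(p,e';f)}$; $\partial(e^{(b)})_\alpha=\delta_✓$ if $\alpha\le\bar b$; and if $\alpha\le b$, then with $k=(\partial(e)_\alpha(✓))^*$ the weighting $\partial(e^{(b)})_\alpha$ takes the value $k\,\partial(e)_\alpha(x)$ at $x\in\{✗\}\cup\mathrm{Out}$, the value $k\,\partial(e)_\alpha(p,e')$ at $(p,e';e^{(b)})$, and $0$ elsewhere. Write $e\sim f$ if some bisimulation on $(\mathrm{Exp},\partial)$ contains $(e,f)$. **Axioms.** Define $E(p)_\alpha=E(v)_\alpha=0$; $E(b)_\alpha=1$ if $\alpha\le b$ and $0$ otherwise; $E(e\,{}_r\!\oplus_sf)_\alpha=rE(e)_\alpha+sE(f)_\alpha$; $E(e+_bf)_\alpha=E(e)_\alpha$ if $\alpha\le b$ and $E(f)_\alpha$ otherwise; $E(e;f)_\alpha=E(e)_\alpha E(f)_\alpha$; $E(e^{(b)})_\alpha=E(\bar b)_\alpha$.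 Let $\equiv$ be the least congruence on $\mathrm{Exp}$ (with Boolean equivalent tests identified, also as guards of choices and loops) such that - $e+_be\equiv e$; $e+_bf\equiv b;e+_bf$; $e+_bf\equiv f+_{\bar b}e$; $(e+_bf)+_cg\equiv e+_{bc}(f+_cg)$; - $e\,{}_r\!\oplus_s(f+_bg)\equiv(e\,{}_r\!\oplus_sf)+_b(e\,{}_r\!\oplus_sg)$; $e\,{}_r\!\oplus_s(f\,{}_t\!\oplus_ug)\equiv e\,{}_r\!\oplus_1(f\,{}_{st}\!\oplus_{su}g)$; $b;(e\,{}_r\!\oplus_sf)\equiv b;(b;e\,{}_r\!\oplus_s\,b;f)$; - $\mathbb 1;e\equiv e\equiv e;\mathbb 1$; $(e;f);g\equiv e;(f;g)$; $\mathbb 0;e\equiv\mathbb 0$; $(e\,{}_r\!\oplus_sf);g\equiv e;g\,{}_r\!\oplus_s\,f;g$; $(e+_bf);g\equiv e;g+_bf;g$; $v;e\equiv v$; $b;c\equiv bc$; - $e^{(b)}\equiv e;e^{(b)}+_b\mathbb 1$; if $e\equiv(f\,{}_r\!\oplus_s\mathbb 1)+_cg$, then $c;e^{(b)}\equiv c;\big((\odot(s^*r);f;e^{(b)})+_b\mathbb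 1\big)$; - $\odot1\equiv\mathbb 1$; $\odot0;e\equiv\odot0$; - $e\,{}_r\!\oplus_se\equiv\odot(r+s);e$; $e\,{}_r\!\oplus_sf\equiv f\,{}_s\!\oplus_re$; $e\,{}_r\!\oplus_s(f\,{}_t\!\oplus_ug)\equiv(e\,{}_r\!\oplus_{st}f)\,{}_1\!\oplus_{su}g$; $e\,{}_{ru}\!\oplus_sf\equiv(\odot u;e)\,{}_r\!\oplus_sf$; - if $g\equiv e;g+_bf$ and $E(e)_\alpha=0$ for all $\alpha\in\mathrm{At}$, then $g\equiv e^{(b)};f$. **Systems.** A system of equations $(X,\tau)$ consists of a finite set $X$ of indeterminates and, for each $x\in X$, a formal guarded choice $\tau(x)$ over all atoms $\alpha$ (in some order) of finite formal weighted sums $\bigoplus_{i}r_i\cdot t_i$ with $r_i\in\mathbb S$, where each term $t_i$ is either an expression $f\in\mathrm{Exp}$ or $g\,y$ with $g\in\mathrm{Exp}$, $y\in X$. For $h:X\to\mathrm{Exp}$ let $h^\#(\tau(x))\in\mathrm{Exp}$ be obtained by replacing each $g\,y$ by $g;h(y)$, where the guarded choice over atoms $\alpha_1,\dots,\alpha_n$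 is unrolled as $w_{\alpha_1}+_{\alpha_1}(w_{\alpha_2}+_{\alpha_2}(\cdots(w_{\alpha_n}+_{\alpha_n}\mathbb 0)))$ and a weighted sum as $t_1\,{}_{r_1}\!\oplus_1(t_2\,{}_{r_2}\!\oplus_1(\cdots(t_m\,{}_{r_m}\!\oplus_1\odot0)))$. The system is *Salomaa* if $E(g)_\alpha=0$ for all $\alpha\in\mathrm{At}$ and all subterms $g\,y$ occurring in it. A map $h:X\to\mathrm{Exp}$ is a solution up to a congruence $R$ if $(h(x),h^\#(\tau(x)))\in R$ for all $x\in X$. Let $\dot\equiv$ be the least congruence on $\mathrm{Exp}$ that contains $\equiv$ and satisfies the Uniqueness Axiom: if $(X,\tau)$ is a Salomaa system and $f,g:X\to\mathrm{Exp}$ are solutions of it up to $\dot\equiv$, then $f(x)\mathrel{\dot\equiv}g(x)$ for all $x\in X$. **Theorem (Soundness of $\dot\equiv$).** For all $e,f\in\mathrm{Exp}$, $e\mathrel{\dot\equiv}f$ implies $e\sim f$. -/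

import Mathlib

namespace WGKAT

/-! ### Tests and atoms -/

/-- Boolean expressions over the primitive tests `T`. -/
inductive BExp (T : Type*) : Type _
  | zero : BExp T
  | one : BExp T
  | prim (t : T) : BExp T
  | compl (b : BExp T) : BExp T
  | disj (b c : BExp T) : BExp T
  | conj (b c : BExp T) : BExp T

/-- Truth value of a test under a truth assignment of the primitive tests. -/
def BExp.eval {T : Type*} (v : T → Bool) : BExp T → Bool
  | zero => false
  | one => true
  | prim t => v t
  | compl b => !(b.eval v)
  | disj b c => b.eval v || c.eval v
  | conj b c => b.eval v && c.eval v

/-- Boolean equivalence of tests: equal truth values under all truth assignments. -/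
def BExp.BEquiv {T : Type*} (b c : BExp T) : Prop := ∀ v : T → Bool, b.eval v = c.eval v

/-- Boolean equivalence as a setoid. -/
instance BExp.setoid (T : Type*) : Setoid (BExp T) where
  r := BExp.BEquiv
  iseqv := ⟨fun _ _ => rfl, fun h v => (h v).symm, fun h h' v => (h v).trans (h' v)⟩

/-- Tests modulo Boolean equivalence: the Boolean algebra freely generated by `T`. -/
def TestAlg (T : Type*) : Type _ := Quotient (BExp.setoid T)

/-- The class of a test. -/
def BExp.cls {T : Type*} (b : BExp T) : TestAlg T := Quotient.mk _ b

/-- Entailment: `[b] ≤ [c]` iff `b + c` is Boolean equivalent to `c`. -/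
instance (T : Type*) : PartialOrder (TestAlg T) where
  le := Quotient.lift₂ (fun b c : BExp T => BExp.BEquiv (b.disj c) c) (by
    intro b c b' c' hb hc
    have hb' : ∀ v, b.eval v = b'.eval v := hb
    have hc' : ∀ v, c.eval v = c'.eval v := hc
    simp only [BExp.BEquiv, BExp.eval, hb', hc'])
  le_refl := by
    rintro ⟨b⟩ v
    simp [BExp.eval]
  le_trans := by
    rintro ⟨a⟩ ⟨b⟩ ⟨c⟩ hab hbc v
    have h1 : (a.eval v || b.eval v) = b.eval v := hab v
    have h2 : (b.eval v || c.eval v) = c.eval v := hbc v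
    change (a.eval v || c.eval v) = c.eval v
    rw [← h2, ← Bool.or_assoc, h1]
  le_antisymm := by
    rintro ⟨a⟩ ⟨b⟩ hab hba
    refine Quotient.sound fun v => ?_
    have h1 : (a.eval v || b.eval v) = b.eval v := hab v
    have h2 : (b.eval v || a.eval v) = a.eval v := hba v
    rw [← h1, Bool.or_comm, h2]

/-- The least element is the class of the false test. -/
instance (T : Type*) : OrderBot (TestAlg T) where
  bot := BExp.zero.cls
  bot_le := by
    rintro ⟨a⟩ v
    simp [BExp.eval]

/-- Atoms: the minimal nonzero elements of the algebra of tests. -/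
def At (T : Type*) : Type _ := {a : TestAlg T // IsAtom a}

/-- `α ≤ b` for an atom `α` and a test `b`. -/
def At.Entails {T : Type*} (α : At T) (b : BExp T) : Prop := α.1 ≤ b.cls

/-- A test representing the atom `α`. -/
noncomputable def At.rep {T : Type*} (α : At T) : BExp T := Quotient.out α.1

/-! ### Semirings of weights -/

/-- Conway semirings. -/
class ConwaySemiring (S : Type*) extends Semiring S where
  /-- The iteration operation. -/
  iter : S → S
  iter_add : ∀ a b : S, iter (a + b) = iter a * iter (b * iter a)
  iter_mul : ∀ a b : S, iter (a * b) = 1 + a * iter (b * a) * b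

/-- Refinement monoids. -/
def IsRefinement (M : Type*) [AddCommMonoid M] : Prop :=
  ∀ x y z w : M, x + y = z + w →
    ∃ s t u v : M, s + t = x ∧ s + u = z ∧ u + v = y ∧ t + v = w

/-- Positive (conical) monoids. -/
def IsPositive (M : Type*) [AddCommMonoid M] : Prop :=
  ∀ x y : M, x + y = 0 → x = 0 ∧ y = 0

/-! ### Expressions -/

/-- Expressions, with actions `Act`, return values `Out` and weights `S`. -/
inductive Exp (T Act Out S : Type*) : Type _
  /-- do `p` -/
  | act (p : Act) : Exp T Act Out S
  /-- assert `b` -/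
  | test (b : BExp T) : Exp T Act Out S
  /-- `e +_b f` -/
  | guard (b : BExp T) (e f : Exp T Act Out S) : Exp T Act Out S
  /-- `e ; f` -/
  | seq (e f : Exp T Act Out S) : Exp T Act Out S
  /-- `e^(b)` -/
  | loop (b : BExp T) (e : Exp T Act Out S) : Exp T Act Out S
  /-- return `v` -/
  | out (v : Out) : Exp T Act Out S
  /-- `e` with weight `r` and `f` with weight `s` -/
  | wchoice (r s : S) (e f : Exp T Act Out S) : Exp T Act Out S

/-- Scaling by `r`, that is, `1` with weight `r` and `0` with weight zero. -/
def Exp.scale {T Act Out S : Type*} [Zero S] (r : S) : Exp T Act Out S :=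
  .wchoice r 0 (.test .one) (.test .zero)

/-! ### Automata and bisimilarity -/

/-- The set `2 + Out + Act × X`. -/
inductive Step (Act Out X : Type*) : Type _
  | accept : Step Act Out X
  | reject : Step Act Out X
  | out (v : Out) : Step Act Out X
  | act (p : Act) (x : X) : Step Act Out X

/-- The total weight `ν[A]` of a set under a finitely supported weighting. -/
noncomputable def weight {Y S : Type*} [AddCommMonoid S] (ν : Y →₀ S) (A : Set Y) : S :=
  open Classical in ∑ y ∈ ν.support with y ∈ A, ν y

/-- Transition functions of automata with states `X`. -/
abbrev Trans (T Act Out S X : Type*) [Zero S] : Type _ := X → At T → (Step Act Out X →₀ S)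

/-- Homomorphisms of automata. -/
structure IsHom {T Act Out S X Y : Type*} [AddCommMonoid S]
    (β : Trans T Act Out S X) (γ : Trans T Act Out S Y) (h : X → Y) : Prop where
  accept : ∀ x α, γ (h x) α .accept = β x α .accept
  reject : ∀ x α, γ (h x) α .reject = β x α .reject
  out : ∀ x α v, γ (h x) α (.out v) = β x α (.out v)
  act : ∀ x α p y, γ (h x) α (.act p y) = weight (β x α) {z | ∃ x', h x' = y ∧ z = .act p x'}

/-- `R` is a bisimulation if it carries a transition function that makes both projections
homomorphisms. -/
def IsBisimulation {T Act Out S X Y : Type*} [AddCommMonoid S]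
    (β : Trans T Act Out S X) (γ : Trans T Act Out S Y) (R : Set (X × Y)) : Prop :=
  ∃ ρ : Trans T Act Out S R, IsHom ρ β (fun z => z.1.1) ∧ IsHom ρ γ (fun z => z.1.2)

/-- Two states are bisimilar if some bisimulation relates them. -/
def Bisimilar {T Act Out S X Y : Type*} [AddCommMonoid S]
    (β : Trans T Act Out S X) (γ : Trans T Act Out S Y) (x : X) (y : Y) : Prop :=
  ∃ R : Set (X × Y), IsBisimulation β γ R ∧ (x, y) ∈ R

/-! ### Operational semantics of expressions -/

section Semantics

variable {T Act Out S : Type*}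

/-- The map whose linearization is the sequential composition of a weighting with `f`, where
`d` is the derivative of `f` at the atom under consideration. -/
noncomputable def seqStep [Semiring S] (d : Step Act Out (Exp T Act Out S) →₀ S)
    (f : Exp T Act Out S) :
    Step Act Out (Exp T Act Out S) → (Step Act Out (Exp T Act Out S) →₀ S)
  | .accept => d
  | .reject => Finsupp.single .reject 1
  | .out v => Finsupp.single (.out v) 1
  | .act p e => Finsupp.single (.act p (e.seq f)) 1

open Classical in
/-- The transition function on expressions. Linearization is `Finsupp.linearCombination`.
If `α ≤ b`, the loop `e^(b)` gets weight zero on acceptance, weight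
`iter (∂(e)_α(✓)) * ∂(e)_α(x)` on rejection and on the return values `x`, weight
`iter (∂(e)_α(✓)) * ∂(e)_α(p, e')` on `(p, e' ; e^(b))`, and weight zero elsewhere; as
`e' ↦ e' ; e^(b)` is injective, this is the linearization below. For an atom `α`, exactly one
of `α ≤ b` and `α ≤ b̄` holds. -/
noncomputable def deriv [ConwaySemiring S] :
    Exp T Act Out S → At T → (Step Act Out (Exp T Act Out S) →₀ S)
  | .act p, _ => Finsupp.single (.act p (.test .one)) 1
  | .test b, α => if α.Entails b then Finsupp.single .accept 1 else Finsupp.single .reject 1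
  | .guard b e f, α => if α.Entails b then deriv e α else deriv f α
  | .seq e f, α => Finsupp.linearCombination S (seqStep (deriv f α) f) (deriv e α)
  | .loop b e, α =>
      if α.Entails b then
        ConwaySemiring.iter (deriv e α .accept) •
          Finsupp.linearCombination S (seqStep 0 (.loop b e)) (deriv e α)
      else Finsupp.single .accept 1
  | .out v, _ => Finsupp.single (.out v) 1
  | .wchoice r s e f, α => r • deriv e α + s • deriv f α

/-- Bisimilarity of expressions, as states of the automaton of expressions. -/
def Exp.Bisim [ConwaySemiring S] (e f : Exp T Act Out S) : Prop :=
  Bisimilar (deriv (T := T) (Act := Act) (Out := Out) (S := S)) deriv e f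

open Classical in
/-- The weight `E(e)_α` of immediate acceptance, defined by recursion on `e`. -/
noncomputable def Exp.E [Semiring S] : Exp T Act Out S → At T → S
  | .act _, _ => 0
  | .test b, α => if α.Entails b then 1 else 0
  | .guard b e f, α => if α.Entails b then e.E α else f.E α
  | .seq e f, α => e.E α * f.E α
  | .loop b _, α => if α.Entails b.compl then 1 else 0
  | .out _, _ => 0
  | .wchoice r s e f, α => r * e.E α + s * f.E α

end Semantics

/-! ### The axiomatization -/

open Exp ConwaySemiring in
/-- Provable equivalence `≡`: the least congruence that satisfies the axioms. Boolean equivalent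
tests are identified, as tests and as the guards of choices and loops. -/
inductive Equiv {T Act Out S : Type*} [ConwaySemiring S] :
    Exp T Act Out S → Exp T Act Out S → Prop
  -- congruence
  | refl (e) : Equiv e e
  | symm {e f} : Equiv e f → Equiv f e
  | trans {e f g} : Equiv e f → Equiv f g → Equiv e g
  | test_congr {b c : BExp T} : b.BEquiv c → Equiv (test b) (test c)
  | guard_congr {b c : BExp T} {e e' f f'} :
      b.BEquiv c → Equiv e e' → Equiv f f' → Equiv (guard b e f) (guard c e' f')
  | seq_congr {e e' f f'} : Equiv e e' → Equiv f f' → Equiv (seq e f) (seq e' f')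
  | loop_congr {b c : BExp T} {e e'} : b.BEquiv c → Equiv e e' → Equiv (loop b e) (loop c e')
  | wchoice_congr {r s : S} {e e' f f'} :
      Equiv e e' → Equiv f f' → Equiv (wchoice r s e f) (wchoice r s e' f')
  -- guarded choice
  | G1 (b : BExp T) (e) : Equiv (guard b e e) e
  | G2 (b : BExp T) (e f) : Equiv (guard b e f) (guard b (seq (test b) e) f)
  | G3 (b : BExp T) (e f) : Equiv (guard b e f) (guard b.compl f e)
  | G4 (b c : BExp T) (e f g) :
      Equiv (guard c (guard b e f) g) (guard (b.conj c) e (guard c f g))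
  -- distributivity
  | D1 (b : BExp T) (r s : S) (e f g) :
      Equiv (wchoice r s e (guard b f g)) (guard b (wchoice r s e f) (wchoice r s e g))
  | D2 (r s t u : S) (e f g) :
      Equiv (wchoice r s e (wchoice t u f g)) (wchoice r 1 e (wchoice (s * t) (s * u) f g))
  | D3 (b : BExp T) (r s : S) (e f) :
      Equiv (seq (test b) (wchoice r s e f))
        (seq (test b) (wchoice r s (seq (test b) e) (seq (test b) f)))
  -- sequencing
  | S1_left (e) : Equiv (seq (test .one) e) e
  | S1_right (e) : Equiv e (seq e (test .one))
  | S2 (e f g) : Equiv (seq (seq e f) g) (seq e (seq f g))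
  | S3 (e) : Equiv (seq (test .zero) e) (test .zero)
  | S4 (r s : S) (e f g) :
      Equiv (seq (wchoice r s e f) g) (wchoice r s (seq e g) (seq f g))
  | S5 (b : BExp T) (e f g) : Equiv (seq (guard b e f) g) (guard b (seq e g) (seq f g))
  | S6 (v : Out) (e) : Equiv (seq (out v) e) (out v)
  | S7 (b c : BExp T) : Equiv (seq (test b) (test c)) (test (b.conj c))
  -- loops
  | L1 (b : BExp T) (e) : Equiv (loop b e) (guard b (seq e (loop b e)) (test .one))
  | L2 {c : BExp T} {r s : S} {e f g} (b : BExp T) :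
      Equiv e (guard c (wchoice r s f (test .one)) g) →
      Equiv (seq (test c) (loop b e))
        (seq (test c)
          (guard b (seq (scale (iter s * r)) (seq f (loop b e))) (test .one)))
  -- scaling
  | C1 : Equiv (scale 1) (test .one)
  | C2 (e) : Equiv (seq (scale 0) e) (scale 0)
  -- weighted choice
  | W1 (r s : S) (e) : Equiv (wchoice r s e e) (seq (scale (r + s)) e)
  | W2 (r s : S) (e f) : Equiv (wchoice r s e f) (wchoice s r f e)
  | W3 (r s t u : S) (e f g) :
      Equiv (wchoice r s e (wchoice t u f g)) (wchoice 1 (s * u) (wchoice r (s * t) e f) g)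
  | W4 (r s u : S) (e f) : Equiv (wchoice (r * u) s e f) (wchoice r s (seq (scale u) e) f)
  -- fixpoint rule
  | F1 {b : BExp T} {e f g} :
      Equiv g (guard b (seq e g) f) → (∀ α, e.E α = 0) → Equiv g (seq (loop b e) f)

/-! ### Systems of equations -/

/-- The terms `f` and `g x` with an indeterminate `x`. -/
inductive TExp (T Act Out S X : Type*) : Type _
  | const (f : Exp T Act Out S) : TExp T Act Out S X
  | app (g : Exp T Act Out S) (x : X) : TExp T Act Out S X

/-- A weighted sum of terms, given by its finite list of weights and terms. -/
abbrev WExp (T Act Out S X : Type*) : Type _ := List (S × TExp T Act Out S X)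

/-- A generalized guarded choice, over all atoms, of weighted sums. As the order in which such
a choice is unrolled is arbitrary, an enumeration of the atoms is part of the data. -/
structure SysExp (T Act Out S X : Type*) : Type _ where
  order : List (At T)
  nodup : order.Nodup
  complete : ∀ α, α ∈ order
  branch : At T → WExp T Act Out S X

section Systems

variable {T Act Out S X : Type*}

/-- Substitution in a term: `f` stays, and `g x` becomes `g ; h x`. -/
def TExp.subst (h : X → Exp T Act Out S) : TExp T Act Out S X → Exp T Act Out S
  | .const f => f
  | .app g x => g.seq (h x)

/-- Substitution in a weighted sum: each summand `r · t` becomes a weighted choice, with weights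
`r` and `1`, between `t` and the remaining sum; the empty sum is scaling by zero. -/
def WExp.subst [Zero S] [One S] (h : X → Exp T Act Out S) :
    WExp T Act Out S X → Exp T Act Out S
  | [] => .scale 0
  | (r, t) :: w => .wchoice r 1 (t.subst h) (WExp.subst h w)

/-- The expression `h^#(t)` that arises by substituting `h x` for each indeterminate `x`. -/
noncomputable def SysExp.subst [Zero S] [One S] (h : X → Exp T Act Out S)
    (t : SysExp T Act Out S X) : Exp T Act Out S :=
  t.order.foldr (fun α e => .guard α.rep ((t.branch α).subst h) e) (.test .zero)

/-- The system `τ` is Salomaa: `E(g)_α = 0` for all atoms `α` and all subterms `g x` in it. -/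
def IsSalomaa [Semiring S] (τ : X → SysExp T Act Out S X) : Prop :=
  ∀ x γ r g y, (r, TExp.app g y) ∈ (τ x).branch γ → ∀ α, g.E α = 0

end Systems

/-- The relation `≐`: the least congruence that contains `≡` and satisfies the uniqueness axiom:
any two solutions, up to `≐`, of a Salomaa system with finitely many indeterminates are
pointwise related. -/
inductive DotEquiv {T Act Out S : Type*} [ConwaySemiring S] :
    Exp T Act Out S → Exp T Act Out S → Prop
  | of_equiv {e f} : Equiv e f → DotEquiv e f
  | symm {e f} : DotEquiv e f → DotEquiv f e
  | trans {e f g} : DotEquiv e f → DotEquiv f g → DotEquiv e g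
  | guard_congr (b : BExp T) {e e' f f'} :
      DotEquiv e e' → DotEquiv f f' → DotEquiv (.guard b e f) (.guard b e' f')
  | seq_congr {e e' f f'} : DotEquiv e e' → DotEquiv f f' → DotEquiv (.seq e f) (.seq e' f')
  | loop_congr (b : BExp T) {e e'} : DotEquiv e e' → DotEquiv (.loop b e) (.loop b e')
  | wchoice_congr (r s : S) {e e' f f'} :
      DotEquiv e e' → DotEquiv f f' → DotEquiv (.wchoice r s e f) (.wchoice r s e' f')
  | UA {X : Type} [Finite X] (τ : X → SysExp T Act Out S X) (f g : X → Exp T Act Out S) :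
      IsSalomaa τ → (∀ x, DotEquiv (f x) ((τ x).subst f)) →
      (∀ x, DotEquiv (g x) ((τ x).subst g)) → ∀ x, DotEquiv (f x) (g x)

end WGKAT

/-! A bisimulation requires a transition structure on a set of pairs, which is awkward to build
axiom by axiom. The proof works instead with behavioural equivalence `beh`, the greatest equivalence
whose related expressions have derivatives with equal images once related states are identified.
Derivatives are built from linear extensions, so the congruence properties and axioms become linear
algebra plus coinduction (`beh_of_coinduction`). Most axioms even have literally equal derivatives
on both sides; the loop axiom `L2` rests on the Conway identity `iter_add_eq`.

Uniqueness of solutions holds by guardedness. If `E(g)_α = 0`, then the unknown in `g;h(y)` is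
reached only after an action, as a continuation `k;h(y)`. Hence two solutions `f`, `g`, together
with all pairs `k;f(x)`, `k;g(x)`, form a coinductive candidate (`beh_of_next_seq`,
`beh_of_solutions`). The fixpoint rule `F1` follows from the same argument.

Positivity and refinement enter only in the return to bisimilarity: two weightings with the same
image have a coupling on the kernel pair (`IsRefinement.exists_coupling`), and couplings of
derivatives make `beh` a bisimulation. -/

namespace WGKAT

/-! ### Entailment by atoms -/

section Atoms

variable {T : Type*}

lemma BExp.cls_le_iff {a b : BExp T} :
    a.cls ≤ b.cls ↔ ∀ v, a.eval v = true → b.eval v = true := by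
  change (∀ v, (a.eval v || b.eval v) = b.eval v) ↔ _
  refine forall_congr' fun v => ?_
  cases a.eval v <;> cases b.eval v <;> simp

lemma At.entails_congr {b c : BExp T} (h : b.BEquiv c) (α : At T) :
    α.Entails b ↔ α.Entails c := by
  have : b.cls = c.cls := Quotient.sound h
  simp only [At.Entails, this]

lemma At.entails_one (α : At T) : α.Entails .one := by
  obtain ⟨⟨a⟩, ha⟩ := α
  exact BExp.cls_le_iff.2 fun _ _ => rfl

lemma At.not_entails_zero (α : At T) : ¬ α.Entails .zero :=
  fun h => α.2.1 (le_bot_iff.1 h)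

lemma At.entails_conj {b c : BExp T} (α : At T) :
    α.Entails (b.conj c) ↔ α.Entails b ∧ α.Entails c := by
  obtain ⟨⟨a⟩, ha⟩ := α
  change a.cls ≤ _ ↔ a.cls ≤ _ ∧ a.cls ≤ _
  simp only [BExp.cls_le_iff, BExp.eval, Bool.and_eq_true]
  grind

/-- An atom is nonzero, so it cannot lie below both a test and its complement; it is minimal, so its
meet with `b` is zero or the atom itself. -/
lemma At.entails_compl {b : BExp T} (α : At T) : α.Entails b.compl ↔ ¬ α.Entails b := by
  obtain ⟨⟨a⟩, ha⟩ := α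
  change IsAtom a.cls at ha
  change a.cls ≤ _ ↔ ¬ a.cls ≤ _
  constructor
  · intro h h'
    refine ha.1 (le_bot_iff.1 (?_ : a.cls ≤ BExp.zero.cls))
    rw [BExp.cls_le_iff] at *
    intro v hv
    have h1 := h v hv
    have h2 := h' v hv
    simp [BExp.eval, h2] at h1
  · intro h
    have hle : (a.conj b).cls ≤ a.cls := BExp.cls_le_iff.2 fun v hv => by
      simp only [BExp.eval, Bool.and_eq_true] at hv
      exact hv.1
    rcases ha.le_iff.1 hle with h0 | h1
    · have h0' : (a.conj b).cls ≤ BExp.zero.cls := h0.le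
      rw [BExp.cls_le_iff] at h0' ⊢
      intro v hv
      have := h0' v
      simpa [BExp.eval, hv] using this
    · refine absurd (BExp.cls_le_iff.2 fun v hv => ?_) h
      have := BExp.cls_le_iff.1 h1.ge v hv
      simp only [BExp.eval, Bool.and_eq_true] at this
      exact this.2

end Atoms

/-! ### Behavioural equivalence -/

/-- The action of a map of states on steps. -/
def Step.map {Act Out X Y : Type*} (h : X → Y) : Step Act Out X → Step Act Out Y
  | .accept => .accept
  | .reject => .reject
  | .out v => .out v
  | .act p x => .act p (h x)

lemma Step.map_surjective {Act Out X Y : Type*} {h : X → Y} (hh : Function.Surjective h) :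
    Function.Surjective (Step.map (Act := Act) (Out := Out) h) := by
  rintro (_ | _ | v | ⟨p, y⟩)
  · exact ⟨.accept, rfl⟩
  · exact ⟨.reject, rfl⟩
  · exact ⟨.out v, rfl⟩
  · obtain ⟨x, rfl⟩ := hh y
    exact ⟨.act p x, rfl⟩

section Quot

variable {Act Out S X : Type*} [Semiring S]

/-- The image of a weighting of steps when related states are identified. -/
noncomputable def quot (R : Setoid X) :
    (Step Act Out X →₀ S) →ₗ[S] (Step Act Out (Quotient R) →₀ S) :=
  Finsupp.lmapDomain S S (Step.map (Quotient.mk R))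

lemma quot_single (R : Setoid X) (x : Step Act Out X) (r : S) :
    quot R (Finsupp.single x r) = Finsupp.single (x.map (Quotient.mk R)) r := by
  simp [quot]

lemma quot_mono {R R' : Setoid X} (h : R ≤ R') {ν μ : Step Act Out X →₀ S}
    (hq : quot R ν = quot R μ) : quot R' ν = quot R' μ := by
  let k : Quotient R → Quotient R' := Quotient.map id fun _ _ hab => h hab
  have hk : (Step.map (Act := Act) (Out := Out) (Quotient.mk R')) =
      Step.map k ∘ Step.map (Quotient.mk R) := by
    funext x
    cases x <;> rfl
  simp only [quot, Finsupp.lmapDomain_apply, hk, Finsupp.mapDomain_comp] at hq ⊢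
  rw [hq]

/-- Linear extensions of maps that respect a relation on states agree on weightings that are
equal up to this relation. -/
lemma linearCombination_eq_of_quot_eq {R : Setoid X} {M : Type*} [AddCommMonoid M] [Module S M]
    {φ ψ : Step Act Out X → M} (hs : ∀ x, φ x = ψ x)
    (h : ∀ p x y, R x y → φ (.act p x) = φ (.act p y))
    {ν μ : Step Act Out X →₀ S} (hq : quot R ν = quot R μ) :
    Finsupp.linearCombination S φ ν = Finsupp.linearCombination S ψ μ := by
  obtain rfl : φ = ψ := funext hs
  have hsurj := Step.map_surjective (Act := Act) (Out := Out)
    (Quotient.mk_surjective (s := R))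
  have hφ : φ = (φ ∘ Function.surjInv hsurj) ∘ Step.map (Quotient.mk R) := by
    have key : ∀ x y : Step Act Out X,
        x.map (Quotient.mk R) = y.map (Quotient.mk R) → φ x = φ y := by
      intro x y hxy
      cases x <;> cases y <;> simp only [Step.map, Step.act.injEq, Step.out.injEq,
        reduceCtorEq] at hxy ⊢
      · rw [hxy]
      · rw [hxy.1]
        exact h _ _ _ (Quotient.exact hxy.2)
    funext x
    exact key _ _ (Function.surjInv_eq hsurj _).symm
  simp only [quot, Finsupp.lmapDomain_apply] at hq
  rw [hφ, ← Finsupp.linearCombination_mapDomain, hq, Finsupp.linearCombination_mapDomain]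

lemma apply_accept_eq_of_quot_eq {R : Setoid X} {ν μ : Step Act Out X →₀ S}
    (hq : quot R ν = quot R μ) : ν .accept = μ .accept := by
  classical
  -- Evaluation at acceptance is the linear extension of a function that ignores states.
  have key : ∀ ξ : Step Act Out X →₀ S, ξ .accept =
      Finsupp.linearCombination S
        (fun x : Step Act Out X => match x with | .accept => (1 : S) | _ => 0) ξ := by
    intro ξ
    rw [Finsupp.linearCombination_apply, Finsupp.sum, Finset.sum_eq_single .accept]
    · simp
    · intro b _ hb
      cases b <;> simp_all
    · intro hx
      simpa using hx
  rw [key, key]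
  exact linearCombination_eq_of_quot_eq (fun _ => rfl) (fun _ _ _ _ => rfl) hq

end Quot

section Behaviour

variable {T Act Out S : Type*} [ConwaySemiring S]

/-- Expressions whose derivatives agree up to `R`. -/
noncomputable def next : Setoid (Exp T Act Out S) →o Setoid (Exp T Act Out S) where
  toFun R :=
    { r := fun e f => ∀ α, quot R (deriv e α) = quot R (deriv f α)
      iseqv := ⟨fun _ _ => rfl, fun h α => (h α).symm, fun h h' α => (h α).trans (h' α)⟩ }
  monotone' := fun _ _ h _ _ hef α => quot_mono h (hef α)

/-- Behavioural equivalence: the greatest relation preserved by the derivatives. -/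
noncomputable def beh : Setoid (Exp T Act Out S) := OrderHom.gfp next

lemma next_beh : next (beh : Setoid (Exp T Act Out S)) = beh := OrderHom.map_gfp next

lemma beh_iff {e f : Exp T Act Out S} :
    beh e f ↔ ∀ α, quot beh (deriv e α) = quot beh (deriv f α) := by
  conv_lhs => rw [← next_beh]
  rfl

lemma beh_of_deriv_eq {e f : Exp T Act Out S} (h : ∀ α, deriv e α = deriv f α) : beh e f :=
  beh_iff.2 fun α => by rw [h]

/-- Coinduction up to behavioural equivalence. -/
lemma beh_of_coinduction (B : Exp T Act Out S → Exp T Act Out S → Prop)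
    (h : ∀ R : Setoid (Exp T Act Out S), beh ≤ R → (∀ x y, B x y → R x y) →
      ∀ x y, B x y → next R x y) {e f : Exp T Act Out S} (hB : B e f) : beh e f := by
  -- As `next` yields an equivalence relation, only the generators need checking: `beh` is a fixed
  -- point, and pairs in `B` are covered by the hypothesis.
  have hle : beh ⊔ Relation.EqvGen.setoid B ≤ next (beh ⊔ Relation.EqvGen.setoid B) := by
    refine sup_le ?_ ?_
    · conv_lhs => rw [← next_beh]
      exact next.monotone le_sup_left
    · exact Setoid.eqvGen_le fun x y hxy => h _ le_sup_left
        (fun x y hxy => (le_sup_right : Relation.EqvGen.setoid B ≤ _) (Relation.EqvGen.rel _ _ hxy))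
        x y hxy
  exact OrderHom.le_gfp next hle
    ((le_sup_right : Relation.EqvGen.setoid B ≤ _) (Relation.EqvGen.rel _ _ hB))

end Behaviour

/-! ### Derivatives -/

section Derivatives

variable {T Act Out S : Type*}

/-- Splits off the part where the first component accepts at once and `f` starts immediately. In the
rest `f` occurs only behind an action; this is also the shape of the loop derivative. -/
lemma linearCombination_seqStep [Semiring S] (d : Step Act Out (Exp T Act Out S) →₀ S)
    (f : Exp T Act Out S) (ν : Step Act Out (Exp T Act Out S) →₀ S) :
    Finsupp.linearCombination S (seqStep d f) ν =
      ν .accept • d + Finsupp.linearCombination S (seqStep 0 f) ν := by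
  induction ν using Finsupp.induction_linear with
  | zero => simp
  | add ν μ hν hμ =>
    rw [map_add, map_add, hν, hμ, Finsupp.add_apply, add_smul]
    abel
  | single x r => cases x <;> simp [seqStep]

lemma linearCombination_seqStep_accept [Semiring S] (d : Step Act Out (Exp T Act Out S) →₀ S)
    (f : Exp T Act Out S) (ν : Step Act Out (Exp T Act Out S) →₀ S) :
    Finsupp.linearCombination S (seqStep d f) ν .accept = ν .accept * d .accept := by
  induction ν using Finsupp.induction_linear with
  | zero => simp
  | add ν μ hν hμ => rw [map_add, Finsupp.add_apply, hν, hμ, Finsupp.add_apply, add_mul]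
  | single x r => cases x <;> simp [seqStep]

/-- Sequential composition of weightings respects relations on states. -/
lemma quot_linearCombination_seqStep [Semiring S] {R R' : Setoid (Exp T Act Out S)}
    {f f' : Exp T Act Out S} {d d' ν μ : Step Act Out (Exp T Act Out S) →₀ S}
    (hR : ∀ k k', R k k' → R' (k.seq f) (k'.seq f')) (hd : quot R' d = quot R' d')
    (hν : quot R ν = quot R μ) :
    quot R' (Finsupp.linearCombination S (seqStep d f) ν) =
      quot R' (Finsupp.linearCombination S (seqStep d' f') μ) := by
  rw [Finsupp.apply_linearCombination, Finsupp.apply_linearCombination]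
  refine linearCombination_eq_of_quot_eq (R := R) ?_ ?_ hν
  · rintro (_ | _ | v | ⟨p, x⟩)
    · exact hd
    · rfl
    · rfl
    · simp only [Function.comp, seqStep, quot_single, Step.map]
      rw [Quotient.sound (hR x x (R.refl x))]
  · intro p x y hxy
    simp only [Function.comp, seqStep, quot_single, Step.map]
    -- Each use of `hR` trades `f` for `f'`, so the path from `x;f` to `y;f` passes through `y;f'`.
    rw [Quotient.sound (hR x y hxy), ← Quotient.sound (hR y y (R.refl y))]

variable [ConwaySemiring S]

lemma deriv_seq (e f : Exp T Act Out S) (α : At T) :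
    deriv (e.seq f) α = Finsupp.linearCombination S (seqStep (deriv f α) f) (deriv e α) := by
  rw [deriv]

lemma deriv_test_of_entails {b : BExp T} {α : At T} (h : α.Entails b) :
    deriv (.test b : Exp T Act Out S) α = Finsupp.single .accept 1 := by
  rw [deriv, if_pos h]

lemma deriv_test_of_not_entails {b : BExp T} {α : At T} (h : ¬ α.Entails b) :
    deriv (.test b : Exp T Act Out S) α = Finsupp.single .reject 1 := by
  rw [deriv, if_neg h]

lemma deriv_test_seq_of_entails {b : BExp T} {α : At T} (h : α.Entails b)
    (e : Exp T Act Out S) : deriv ((Exp.test b).seq e) α = deriv e α := by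
  simp [deriv_seq, deriv_test_of_entails h, seqStep]

lemma deriv_test_seq_of_not_entails {b : BExp T} {α : At T} (h : ¬ α.Entails b)
    (e : Exp T Act Out S) : deriv ((Exp.test b).seq e) α = Finsupp.single .reject 1 := by
  simp [deriv_seq, deriv_test_of_not_entails h, seqStep]

lemma deriv_guard_of_entails {b : BExp T} {α : At T} (h : α.Entails b) (e f : Exp T Act Out S) :
    deriv (.guard b e f) α = deriv e α := by
  rw [deriv, if_pos h]

lemma deriv_guard_of_not_entails {b : BExp T} {α : At T} (h : ¬ α.Entails b)
    (e f : Exp T Act Out S) : deriv (.guard b e f) α = deriv f α := by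
  rw [deriv, if_neg h]

lemma deriv_wchoice (r s : S) (e f : Exp T Act Out S) (α : At T) :
    deriv (.wchoice r s e f) α = r • deriv e α + s • deriv f α := by
  rw [deriv]

lemma deriv_scale (r : S) (α : At T) :
    deriv (.scale r : Exp T Act Out S) α = Finsupp.single .accept r := by
  simp [Exp.scale, deriv_wchoice, deriv_test_of_entails α.entails_one]

lemma deriv_scale_seq (r : S) (e : Exp T Act Out S) (α : At T) :
    deriv ((Exp.scale r).seq e) α = r • deriv e α := by
  simp [deriv_seq, deriv_scale, seqStep]

lemma deriv_loop_of_entails {b : BExp T} {α : At T} (h : α.Entails b) (e : Exp T Act Out S) :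
    deriv (.loop b e) α = ConwaySemiring.iter (deriv e α .accept) •
      Finsupp.linearCombination S (seqStep 0 (.loop b e)) (deriv e α) := by
  rw [deriv, if_pos h]

lemma deriv_loop_of_not_entails {b : BExp T} {α : At T} (h : ¬ α.Entails b)
    (e : Exp T Act Out S) : deriv (.loop b e) α = Finsupp.single .accept 1 := by
  rw [deriv, if_neg h]

/-- Turns the syntactic side condition of `F1` and of Salomaa systems into a fact about derivatives.
-/
lemma E_eq_deriv_accept (e : Exp T Act Out S) (α : At T) : e.E α = deriv e α .accept := by
  induction e with
  | act p => simp [Exp.E, deriv]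
  | test b => by_cases h : α.Entails b <;> simp [Exp.E, deriv, h]
  | guard b e f he hf => by_cases h : α.Entails b <;> simp [Exp.E, deriv, h, he, hf]
  | seq e f he hf => rw [Exp.E, deriv_seq, linearCombination_seqStep_accept, he, hf]
  | loop b e he =>
    by_cases h : α.Entails b
    · simp [Exp.E, α.entails_compl, deriv_loop_of_entails h, h, linearCombination_seqStep_accept]
    · simp [Exp.E, α.entails_compl, deriv_loop_of_not_entails h, h]
  | out v => simp [Exp.E, deriv]
  | wchoice r s e f he hf => simp [Exp.E, deriv, he, hf]

lemma deriv_seq_of_E_eq_zero {e : Exp T Act Out S} {α : At T} (h : e.E α = 0)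
    (f : Exp T Act Out S) :
    deriv (e.seq f) α = Finsupp.linearCombination S (seqStep 0 f) (deriv e α) := by
  rw [deriv_seq, linearCombination_seqStep, ← E_eq_deriv_accept, h, zero_smul, zero_add]

end Derivatives

/-! ### Iteration in Conway semirings -/

section Conway

variable {S : Type*} [ConwaySemiring S]

open ConwaySemiring

lemma iter_eq_one_add_mul (a : S) : iter a = 1 + a * iter a := by
  simpa using iter_mul a 1

/-- Unfold the outer star of `s^*(a s^*)^*` once. This is the scalar content of `L2`. -/
lemma iter_add_eq (s a : S) : iter (a + s) = iter s * a * iter (a + s) + iter s := by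
  have h := iter_eq_one_add_mul (a * iter s)
  rw [add_comm a s, iter_add]
  nth_rewrite 1 [h]
  simp only [mul_add, mul_one, mul_assoc]
  exact add_comm _ _

end Conway

/-! ### Congruence -/

section Congruence

variable {T Act Out S : Type*} [ConwaySemiring S]

/-- Choices do not alter successor states, so `R` can be arbitrary; the uniqueness argument needs
this for relations still under construction. -/
lemma next_guard {R : Setoid (Exp T Act Out S)} {b c : BExp T} (hb : b.BEquiv c)
    {e e' f f' : Exp T Act Out S} (he : next R e e') (hf : next R f f') :
    next R (.guard b e f) (.guard c e' f') := by
  intro α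
  have hbc := α.entails_congr hb
  by_cases h : α.Entails b
  · rw [deriv_guard_of_entails h, deriv_guard_of_entails (hbc.1 h)]
    exact he α
  · rw [deriv_guard_of_not_entails h, deriv_guard_of_not_entails (mt hbc.2 h)]
    exact hf α

lemma next_wchoice {R : Setoid (Exp T Act Out S)} (r s : S)
    {e e' f f' : Exp T Act Out S} (he : next R e e') (hf : next R f f') :
    next R (.wchoice r s e f) (.wchoice r s e' f') := by
  intro α
  simp only [deriv_wchoice, map_add, map_smul]
  rw [he α, hf α]

lemma beh_guard {b c : BExp T} (hb : b.BEquiv c) {e e' f f' : Exp T Act Out S}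
    (he : beh e e') (hf : beh f f') : beh (.guard b e f) (.guard c e' f') := by
  rw [← next_beh] at he hf ⊢
  exact next_guard hb he hf

lemma beh_wchoice (r s : S) {e e' f f' : Exp T Act Out S}
    (he : beh e e') (hf : beh f f') : beh (.wchoice r s e f) (.wchoice r s e' f') := by
  rw [← next_beh] at he hf ⊢
  exact next_wchoice r s he hf

/-- A successor of `k;f` is either `l;f` for a successor `l` of `k`, which stays in the candidate
relation, or a successor of `f`, which is handled up to `beh`. -/
lemma beh_seq {e e' f f' : Exp T Act Out S} (he : beh e e') (hf : beh f f') :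
    beh (e.seq f) (e'.seq f') := by
  refine beh_of_coinduction (fun x y => ∃ k k', beh k k' ∧ x = k.seq f ∧ y = k'.seq f')
    ?_ ⟨e, e', he, rfl, rfl⟩
  rintro R hle hB _ _ ⟨k, k', hk, rfl, rfl⟩ α
  rw [deriv_seq, deriv_seq]
  exact quot_linearCombination_seqStep (R := beh)
    (fun l l' hl => hB _ _ ⟨l, l', hl, rfl, rfl⟩)
    (quot_mono hle (beh_iff.1 hf α)) (beh_iff.1 hk α)

/-- Equivalent bodies have equal acceptance weights, hence equal star factors. Successors of a loop
have the form `k;e^(b)`, so the candidate must include such pairs. -/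
lemma beh_loop {b c : BExp T} (hb : b.BEquiv c) {e e' : Exp T Act Out S} (he : beh e e') :
    beh (.loop b e) (.loop c e') := by
  refine beh_of_coinduction (fun x y => (x = .loop b e ∧ y = .loop c e') ∨
    ∃ k k', beh k k' ∧ x = k.seq (.loop b e) ∧ y = k'.seq (.loop c e')) ?_ (.inl ⟨rfl, rfl⟩)
  intro R hle hB
  have hloop : next R (.loop b e) (.loop c e') := by
    intro α
    have hbc := α.entails_congr hb
    have heα := beh_iff.1 he α
    by_cases h : α.Entails b
    · rw [deriv_loop_of_entails h, deriv_loop_of_entails (hbc.1 h), map_smul, map_smul,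
        apply_accept_eq_of_quot_eq heα]
      congr 1
      exact quot_linearCombination_seqStep (R := beh)
        (fun l l' hl => hB _ _ (.inr ⟨l, l', hl, rfl, rfl⟩)) rfl heα
    · rw [deriv_loop_of_not_entails h, deriv_loop_of_not_entails (mt hbc.2 h)]
  rintro _ _ (⟨rfl, rfl⟩ | ⟨k, k', hk, rfl, rfl⟩)
  · exact hloop
  · intro α
    rw [deriv_seq, deriv_seq]
    exact quot_linearCombination_seqStep (R := beh)
      (fun l l' hl => hB _ _ (.inr ⟨l, l', hl, rfl, rfl⟩)) (hloop α) (beh_iff.1 hk α)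

end Congruence

/-! ### Uniqueness of solutions -/

section Uniqueness

variable {T Act Out S X : Type*} [ConwaySemiring S]

/-- The coinduction shared by `F1` and the uniqueness axiom: prefixing by a common `k` preserves
agreement of derivatives, so only the unprefixed pairs remain to be checked. -/
lemma beh_of_next_seq (f g : X → Exp T Act Out S)
    (h : ∀ R : Setoid (Exp T Act Out S), beh ≤ R →
      (∀ (k : Exp T Act Out S) x, R (k.seq (f x)) (k.seq (g x))) → ∀ x, next R (f x) (g x))
    (x : X) : beh (f x) (g x) := by
  refine beh_of_coinduction (fun e e' => ∃ x, (e = f x ∧ e' = g x) ∨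
    ∃ k : Exp T Act Out S, e = k.seq (f x) ∧ e' = k.seq (g x)) ?_ ⟨x, .inl ⟨rfl, rfl⟩⟩
  intro R hle hB
  have hseq : ∀ (k : Exp T Act Out S) x, R (k.seq (f x)) (k.seq (g x)) :=
    fun k x => hB _ _ ⟨x, .inr ⟨k, rfl, rfl⟩⟩
  have hnext := h R hle hseq
  rintro _ _ ⟨x, ⟨rfl, rfl⟩ | ⟨k, rfl, rfl⟩⟩
  · exact hnext x
  · intro α
    rw [deriv_seq, deriv_seq]
    -- The prefix is literally the same on both sides, so equality is the relation used for it.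
    refine quot_linearCombination_seqStep (R := ⊥) ?_ (hnext x α) rfl
    rintro k k' rfl
    exact hseq k x

/-- Guardedness: as `e` never accepts at once, the derivatives of `f` and `g` do not contribute, and
no relation between `f` and `g` themselves is required. -/
lemma next_seq_of_E_eq_zero {R : Setoid (Exp T Act Out S)} {e f g : Exp T Act Out S}
    (he : ∀ α, e.E α = 0) (h : ∀ k : Exp T Act Out S, R (k.seq f) (k.seq g)) :
    next R (e.seq f) (e.seq g) := by
  intro α
  rw [deriv_seq_of_E_eq_zero (he α), deriv_seq_of_E_eq_zero (he α)]
  refine quot_linearCombination_seqStep (R := ⊥) ?_ rfl rfl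
  rintro k k' rfl
  exact h k

lemma next_subst {R : Setoid (Exp T Act Out S)} {f g : X → Exp T Act Out S}
    (h : ∀ (k : Exp T Act Out S) x, R (k.seq (f x)) (k.seq (g x))) (t : SysExp T Act Out S X)
    (ht : ∀ γ r k y, (r, TExp.app k y) ∈ t.branch γ → ∀ α, k.E α = 0) :
    next R (t.subst f) (t.subst g) := by
  have hw : ∀ w : WExp T Act Out S X, (∀ r k y, (r, TExp.app k y) ∈ w → ∀ α, k.E α = 0) →
      next R (w.subst f) (w.subst g) := by
    intro w
    induction w with
    | nil => exact fun _ => (next R).refl _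
    | cons a w ih =>
      intro hw
      obtain ⟨r, t⟩ := a
      refine next_wchoice r 1 ?_ (ih fun r k y hm => hw r k y (List.mem_cons_of_mem _ hm))
      cases t with
      | const e => exact (next R).refl _
      | app k y => exact next_seq_of_E_eq_zero (hw r k y List.mem_cons_self) fun l => h l y
  unfold SysExp.subst
  induction t.order with
  | nil => exact (next R).refl _
  | cons γ l ih => exact next_guard (fun _ => rfl) (hw _ (ht γ)) ih

lemma beh_of_solutions {τ : X → SysExp T Act Out S X} (hτ : IsSalomaa τ)
    {f g : X → Exp T Act Out S} (hf : ∀ x, beh (f x) ((τ x).subst f))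
    (hg : ∀ x, beh (g x) ((τ x).subst g)) (x : X) : beh (f x) (g x) := by
  refine beh_of_next_seq f g (fun R hle h x => ?_) x
  have hle' : beh ≤ next R := by
    rw [← next_beh]
    exact next.monotone hle
  exact (next R).trans (hle' (hf x))
    ((next R).trans (next_subst h (τ x) (hτ x)) ((next R).symm (hle' (hg x))))

end Uniqueness

/-! ### Soundness of the axioms -/

section Axioms

variable {T Act Out S : Type*} [ConwaySemiring S]

lemma beh_seq_one (e : Exp T Act Out S) : beh e (e.seq (.test .one)) := by
  refine beh_of_coinduction (fun x y => y = x.seq (.test .one)) ?_ rfl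
  rintro R - hB e _ rfl α
  rw [deriv_seq, deriv_test_of_entails α.entails_one]
  -- Both sides are linear in the derivative of `e`, so a single step suffices.
  induction deriv e α using Finsupp.induction_linear with
  | zero => simp
  | add ν μ hν hμ => simp only [map_add, hν, hμ]
  | single x r =>
    cases x with
    | act p k =>
      rw [Finsupp.linearCombination_single, seqStep, map_smul, quot_single, quot_single, Step.map,
        Step.map, Quotient.sound (hB k _ rfl), Finsupp.smul_single, smul_eq_mul, mul_one]
    | _ => simp [seqStep]

lemma beh_seq_assoc (e f g : Exp T Act Out S) :
    beh ((e.seq f).seq g) (e.seq (f.seq g)) := by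
  refine beh_of_coinduction
    (fun x y => ∃ k : Exp T Act Out S, x = (k.seq f).seq g ∧ y = k.seq (f.seq g)) ?_ ⟨e, rfl, rfl⟩
  rintro R - hB _ _ ⟨e, rfl, rfl⟩ α
  simp only [deriv_seq]
  induction deriv e α using Finsupp.induction_linear with
  | zero => simp
  | add ν μ hν hμ => simp only [map_add, hν, hμ]
  | single x r =>
    cases x with
    | act p k =>
      simp only [Finsupp.linearCombination_single, seqStep, map_smul, quot_single, Step.map,
        one_smul]
      rw [Quotient.sound (hB _ _ ⟨k, rfl, rfl⟩)]
    | _ => simp [seqStep]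

lemma beh_guard_seq (b : BExp T) (e f g : Exp T Act Out S) :
    beh ((Exp.guard b e f).seq g) (.guard b (e.seq g) (f.seq g)) := by
  refine beh_of_deriv_eq fun α => ?_
  by_cases h : α.Entails b <;> simp [deriv, h]

/-- With `a` the acceptance weight of `e`, this reduces on atoms below `b` to `a^* = 1 + a a^*`. -/
lemma beh_loop_unroll (b : BExp T) (e : Exp T Act Out S) :
    beh (.loop b e) (.guard b (e.seq (.loop b e)) (.test .one)) := by
  refine beh_of_deriv_eq fun α => ?_
  by_cases h : α.Entails b
  · rw [deriv_guard_of_entails h, deriv_seq, linearCombination_seqStep, deriv_loop_of_entails h,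
      smul_smul]
    conv_lhs => rw [iter_eq_one_add_mul, add_smul, one_smul, add_comm]
  · rw [deriv_guard_of_not_entails h, deriv_loop_of_not_entails h,
      deriv_test_of_entails α.entails_one]

/-- Below `b` and `c`, both sides are, up to `beh`, multiples of the derivative of `f` followed by
the loop. With `a` equal to `r` times the acceptance weight of `f`, the body accepts with weight `a
+ s`, and the coefficients agree by `iter_add_eq`. -/
lemma beh_loop_of_accept {b c : BExp T} {r s : S} {e f g : Exp T Act Out S}
    (he : beh e (.guard c (.wchoice r s f (.test .one)) g)) :
    beh ((Exp.test c).seq (.loop b e))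
      ((Exp.test c).seq (.guard b
        ((Exp.scale (ConwaySemiring.iter s * r)).seq (f.seq (.loop b e))) (.test .one))) := by
  refine beh_iff.2 fun α => ?_
  by_cases hc : α.Entails c
  · rw [deriv_test_seq_of_entails hc, deriv_test_seq_of_entails hc]
    by_cases hb : α.Entails b
    · have heα := beh_iff.1 he α
      rw [deriv_guard_of_entails hc, deriv_wchoice, deriv_test_of_entails α.entails_one] at heα
      have hacc : deriv e α .accept = r * deriv f α .accept + s := by
        simpa using apply_accept_eq_of_quot_eq heα
      have hL : quot beh (deriv (.loop b e) α) =
          ConwaySemiring.iter (r * deriv f α .accept + s) • r •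
            quot beh (Finsupp.linearCombination S (seqStep 0 (.loop b e)) (deriv f α)) := by
        rw [deriv_loop_of_entails hb, hacc, map_smul,
          quot_linearCombination_seqStep (R := beh) (f' := .loop b e) (d' := 0)
            (fun k k' hk => beh_seq hk (beh.refl _)) rfl heα]
        simp [seqStep]
      rw [deriv_guard_of_entails hb, deriv_scale_seq, deriv_seq, linearCombination_seqStep,
        map_smul, map_add, map_smul, hL]
      simp only [smul_smul, smul_add, ← add_smul]
      congr 1
      conv_lhs => rw [iter_add_eq]
      simp only [add_mul, mul_assoc]
    · rw [deriv_guard_of_not_entails hb, deriv_loop_of_not_entails hb,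
        deriv_test_of_entails α.entails_one]
  · rw [deriv_test_seq_of_not_entails hc, deriv_test_seq_of_not_entails hc]

/-- Uniqueness with one unknown: unrolling shows that `e^(b);f` solves the same guarded equation as
`g`. -/
lemma beh_fixpoint {b : BExp T} {e f g : Exp T Act Out S}
    (hg : beh g (.guard b (e.seq g) f)) (he : ∀ α, e.E α = 0) :
    beh g ((Exp.loop b e).seq f) := by
  refine beh_of_next_seq (X := Unit) (fun _ => g) (fun _ => (Exp.loop b e).seq f)
    (fun R hle h _ => ?_) ()
  have hle' : beh ≤ next R := by
    rw [← next_beh]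
    exact next.monotone hle
  have hL : beh ((Exp.loop b e).seq f) (.guard b (e.seq ((Exp.loop b e).seq f)) f) :=
    beh.trans (beh_seq (beh_loop_unroll b e) (beh.refl f)) <|
      beh.trans (beh_guard_seq b _ _ f)
        (beh_guard (fun _ => rfl) (beh_seq_assoc _ _ _)
          (beh_of_deriv_eq fun α => deriv_test_seq_of_entails α.entails_one f))
  exact (next R).trans (hle' hg) ((next R).trans
    (next_guard (fun _ => rfl) (next_seq_of_E_eq_zero he fun k => h k ()) ((next R).refl f))
    ((next R).symm (hle' hL)))

lemma beh_of_equiv {e f : Exp T Act Out S} (h : Equiv e f) : beh e f := by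
  induction h with
  | refl e => exact beh.refl e
  | symm _ ih => exact beh.symm ih
  | trans _ _ ih ih' => exact beh.trans ih ih'
  | @test_congr b c hb =>
    refine beh_of_deriv_eq fun α => ?_
    by_cases h : α.Entails b
    · rw [deriv_test_of_entails h, deriv_test_of_entails ((α.entails_congr hb).1 h)]
    · rw [deriv_test_of_not_entails h, deriv_test_of_not_entails (mt (α.entails_congr hb).2 h)]
  | guard_congr hb _ _ he hf => exact beh_guard hb he hf
  | seq_congr _ _ he hf => exact beh_seq he hf
  | loop_congr hb _ he => exact beh_loop hb he
  | wchoice_congr _ _ he hf => exact beh_wchoice _ _ he hf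
  | G1 b e => exact beh_of_deriv_eq fun α => by simp [deriv]
  | G2 b e f =>
    refine beh_of_deriv_eq fun α => ?_
    by_cases h : α.Entails b
    · rw [deriv_guard_of_entails h, deriv_guard_of_entails h, deriv_test_seq_of_entails h]
    · rw [deriv_guard_of_not_entails h, deriv_guard_of_not_entails h]
  | G3 b e f =>
    refine beh_of_deriv_eq fun α => ?_
    by_cases h : α.Entails b <;> simp [deriv, α.entails_compl, h]
  | G4 b c e f g =>
    refine beh_of_deriv_eq fun α => ?_
    by_cases h : α.Entails b <;> by_cases h' : α.Entails c <;>
      simp [deriv, α.entails_conj, h, h']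
  | D1 b r s e f g =>
    refine beh_of_deriv_eq fun α => ?_
    by_cases h : α.Entails b <;> simp [deriv, h]
  | D2 r s t u e f g => exact beh_of_deriv_eq fun α => by simp [deriv, smul_smul]
  | D3 b r s e f =>
    refine beh_of_deriv_eq fun α => ?_
    by_cases h : α.Entails b
    · simp only [deriv_test_seq_of_entails h, deriv_wchoice]
    · simp only [deriv_test_seq_of_not_entails h]
  | S1_left e => exact beh_of_deriv_eq fun α => deriv_test_seq_of_entails α.entails_one e
  | S1_right e => exact beh_seq_one e
  | S2 e f g => exact beh_seq_assoc e f g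
  | S3 e =>
    exact beh_of_deriv_eq fun α => by
      rw [deriv_test_seq_of_not_entails α.not_entails_zero,
        deriv_test_of_not_entails α.not_entails_zero]
  | S4 r s e f g => exact beh_of_deriv_eq fun α => by simp [deriv]
  | S5 b e f g => exact beh_guard_seq b e f g
  | S6 v e => exact beh_of_deriv_eq fun α => by simp [deriv, seqStep]
  | S7 b c =>
    refine beh_of_deriv_eq fun α => ?_
    by_cases h : α.Entails b <;> by_cases h' : α.Entails c <;>
      simp [deriv, α.entails_conj, h, h', seqStep]
  | L1 b e => exact beh_loop_unroll b e
  | L2 b _ ih => exact beh_loop_of_accept ih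
  | C1 =>
    exact beh_of_deriv_eq fun α => by rw [deriv_scale, deriv_test_of_entails α.entails_one]
  | C2 e => exact beh_of_deriv_eq fun α => by simp [deriv_scale_seq, deriv_scale]
  | W1 r s e => exact beh_of_deriv_eq fun α => by rw [deriv_scale_seq, deriv_wchoice, add_smul]
  | W2 r s e f => exact beh_of_deriv_eq fun α => by rw [deriv_wchoice, deriv_wchoice, add_comm]
  | W3 r s t u e f g =>
    exact beh_of_deriv_eq fun α => by simp [deriv_wchoice, smul_smul, add_assoc]
  | W4 r s u e f =>
    exact beh_of_deriv_eq fun α => by simp [deriv_wchoice, deriv_scale_seq, smul_smul]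
  | F1 _ he ih => exact beh_fixpoint ih he

lemma beh_of_dotEquiv {e f : Exp T Act Out S} (h : DotEquiv e f) : beh e f := by
  induction h with
  | of_equiv h => exact beh_of_equiv h
  | symm _ ih => exact beh.symm ih
  | trans _ _ ih ih' => exact beh.trans ih ih'
  | guard_congr b _ _ he hf => exact beh_guard (fun _ => rfl) he hf
  | seq_congr _ _ he hf => exact beh_seq he hf
  | loop_congr b _ he => exact beh_loop (fun _ => rfl) he
  | wchoice_congr r s _ _ he hf => exact beh_wchoice r s he hf
  | UA τ f g hτ _ _ x hf hg => exact beh_of_solutions hτ hf hg x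

end Axioms

/-! ### Couplings of weightings -/

section Coupling

variable {S Y Z : Type*} [AddCommMonoid S]

lemma IsPositive.finsupp (hpos : IsPositive S) : IsPositive (Z →₀ S) := by
  intro x y h
  have hz : ∀ z, x z = 0 ∧ y z = 0 := fun z => hpos _ _ (by
    simpa using DFunLike.congr_fun h z)
  exact ⟨Finsupp.ext fun z => (hz z).1, Finsupp.ext fun z => (hz z).2⟩

/-- Refine pointwise. Positivity forces the chosen parts to vanish wherever `x` and `y` do, so they
have finite support. -/
lemma IsRefinement.finsupp (hpos : IsPositive S) (href : IsRefinement S) :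
    IsRefinement (Z →₀ S) := by
  classical
  intro x y z w h
  have hp : ∀ a, ∃ s t u v : S, s + t = x a ∧ s + u = z a ∧ u + v = y a ∧ t + v = w a :=
    fun a => href _ _ _ _ (by simpa using DFunLike.congr_fun h a)
  choose s t u v hs ht hu hv using hp
  let F := x.support ∪ y.support
  have hF : ∀ a, a ∉ F → s a = 0 ∧ t a = 0 ∧ u a = 0 ∧ v a = 0 := by
    intro a ha
    simp only [F, Finset.mem_union, Finsupp.mem_support_iff, not_or, not_not] at ha
    obtain ⟨h1, h2⟩ := hpos _ _ ((hs a).trans ha.1)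
    obtain ⟨h3, h4⟩ := hpos _ _ ((hu a).trans ha.2)
    exact ⟨h1, h2, h3, h4⟩
  have mem : ∀ k : Z → S, (∀ a, a ∉ F → k a = 0) → ∀ a, k a ≠ 0 → a ∈ F :=
    fun k hk a ha => by_contra fun h => ha (hk a h)
  refine ⟨Finsupp.onFinset F s (mem s fun a ha => (hF a ha).1),
    Finsupp.onFinset F t (mem t fun a ha => (hF a ha).2.1),
    Finsupp.onFinset F u (mem u fun a ha => (hF a ha).2.2.1),
    Finsupp.onFinset F v (mem v fun a ha => (hF a ha).2.2.2), ?_, ?_, ?_, ?_⟩ <;>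
  · ext a
    simp [hs, ht, hu, hv]

lemma IsPositive.mapDomain_eq_zero (hpos : IsPositive S) {q : Y → Z} {μ : Y →₀ S}
    (h : μ.mapDomain q = 0) : μ = 0 := by
  induction μ using Finsupp.induction with
  | zero => rfl
  | single_add a r μ _ hr ih =>
    rw [Finsupp.mapDomain_add, Finsupp.mapDomain_single] at h
    exact absurd (Finsupp.single_eq_zero.1 (hpos.finsupp _ _ h).1) hr

lemma IsPositive.eq_single_of_add_eq_single (hpos : IsPositive S) {θ θ' : Z →₀ S} {z : Z} {r : S}
    (h : θ + θ' = Finsupp.single z r) : θ = Finsupp.single z (θ z) := by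
  classical
  ext a
  by_cases ha : z = a
  · subst ha; simp
  · have := DFunLike.congr_fun h a
    rw [Finsupp.single_eq_of_ne (Ne.symm ha)] at this ⊢
    exact (hpos _ _ this).1

/-- A decomposition of an image weighting lifts to the original weighting. -/
lemma IsRefinement.exists_lift_add (hpos : IsPositive S) (href : IsRefinement S) {q : Y → Z}
    (μ : Y →₀ S) (η η' : Z →₀ S) (h : μ.mapDomain q = η + η') :
    ∃ ν ν' : Y →₀ S, ν + ν' = μ ∧ ν.mapDomain q = η ∧ ν'.mapDomain q = η' := by
  induction μ using Finsupp.induction generalizing η η' with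
  | zero =>
    obtain ⟨rfl, rfl⟩ := hpos.finsupp _ _ (h.symm.trans Finsupp.mapDomain_zero)
    exact ⟨0, 0, by simp⟩
  | single_add a r μ _ _ ih =>
    rw [Finsupp.mapDomain_add, Finsupp.mapDomain_single] at h
    -- The mass at `q a` splits as `s + t` and the image of the rest as `u + v`. Positivity keeps
    -- `s` and `t` at `q a`, so they lift to `a`; induction lifts `u` and `v`.
    obtain ⟨s, t, u, v, hst, hsu, huv, htv⟩ := href.finsupp hpos _ _ _ _ h
    obtain ⟨ν, ν', rfl, hν, hν'⟩ := ih u v huv.symm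
    have hs := hpos.eq_single_of_add_eq_single hst
    have ht := hpos.eq_single_of_add_eq_single ((add_comm t s).trans hst)
    refine ⟨Finsupp.single a (s (q a)) + ν, Finsupp.single a (t (q a)) + ν', ?_, ?_, ?_⟩
    · have hr : s (q a) + t (q a) = r := by
        simpa using DFunLike.congr_fun hst (q a)
      rw [← hr, Finsupp.single_add]
      abel
    · rw [Finsupp.mapDomain_add, Finsupp.mapDomain_single, ← hs, hν, hsu]
    · rw [Finsupp.mapDomain_add, Finsupp.mapDomain_single, ← ht, hν', htv]

/-- Weightings with the same image have a coupling supported on the kernel pair. -/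
lemma IsRefinement.exists_coupling (hpos : IsPositive S) (href : IsRefinement S) {q : Y → Z}
    (ν μ : Y →₀ S) (h : ν.mapDomain q = μ.mapDomain q) :
    ∃ ρ : {z : Y × Y // q z.1 = q z.2} →₀ S,
      ρ.mapDomain (fun z => z.1.1) = ν ∧ ρ.mapDomain (fun z => z.1.2) = μ := by
  classical
  induction ν using Finsupp.induction generalizing μ with
  | zero =>
    obtain rfl := hpos.mapDomain_eq_zero (h.symm.trans Finsupp.mapDomain_zero)
    exact ⟨0, by simp⟩
  | single_add a r ν _ _ ih =>
    rw [Finsupp.mapDomain_add, Finsupp.mapDomain_single] at h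
    -- `μ₁` is the share of `μ` to be coupled with the point mass at `a`; `μ₂` is left to the
    -- induction.
    obtain ⟨μ₁, μ₂, rfl, h₁, h₂⟩ := href.exists_lift_add hpos μ _ _ h.symm
    obtain ⟨ρ, hρ, hρ'⟩ := ih μ₂ h₂.symm
    -- The default `(a, a)` only makes `k` total: it is never used on the support of `μ₁`.
    let k : Y → {z : Y × Y // q z.1 = q z.2} :=
      fun y => if hy : q a = q y then ⟨(a, y), hy⟩ else ⟨(a, a), rfl⟩
    have hk₁ : (fun z : {z : Y × Y // q z.1 = q z.2} => z.1.1) ∘ k = fun _ => a := by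
      funext y
      by_cases hy : q a = q y <;> simp [k, hy]
    refine ⟨μ₁.mapDomain k + ρ, ?_, ?_⟩
    · rw [Finsupp.mapDomain_add, hρ, ← Finsupp.mapDomain_comp, hk₁]
      congr 1
      -- Collapsing everything to `a` shows that `μ₁` has total mass `r`.
      have htot := congrArg (Finsupp.mapDomain fun _ => a) h₁
      rwa [← Finsupp.mapDomain_comp, Finsupp.mapDomain_single] at htot
    · rw [Finsupp.mapDomain_add, hρ', ← Finsupp.mapDomain_comp]
      congr 1
      conv_rhs => rw [← Finsupp.mapDomain_id (v := μ₁)]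
      refine Finsupp.mapDomain_congr fun y hy => ?_
      suffices hq : q a = q y by simp [k, hq]
      -- Outside the fibre of `q a`, the weight `μ₁ y` would be a summand of zero, which positivity
      -- excludes on the support.
      by_contra hne
      have hsplit : Finsupp.single y (μ₁ y) + μ₁.erase y = μ₁ := Finsupp.single_add_erase y μ₁
      rw [← hsplit, Finsupp.mapDomain_add, Finsupp.mapDomain_single] at h₁
      have h0 := DFunLike.congr_fun h₁ (q y)
      rw [Finsupp.single_eq_of_ne (Ne.symm hne), Finsupp.add_apply, Finsupp.single_eq_same] at h0
      exact Finsupp.mem_support_iff.1 hy (hpos _ _ h0).1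

lemma mapDomain_apply_eq_weight (g : Y → Z) (ν : Y →₀ S) (z : Z) :
    ν.mapDomain g z = weight ν {y | g y = z} := by
  classical
  rw [weight, Finsupp.mapDomain, Finsupp.sum, Finsupp.finsetSum_apply, Finset.sum_filter]
  refine Finset.sum_congr ?_ fun y _ => ?_
  · rfl
  · simp [Finsupp.single_apply]

lemma isHom_of_mapDomain {T Act Out X X' : Type*} {β : Trans T Act Out S X}
    {γ : Trans T Act Out S X'} {h : X → X'}
    (hh : ∀ x α, (β x α).mapDomain (Step.map h) = γ (h x) α) : IsHom β γ h := by
  classical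
  -- A step without a successor state has exactly one preimage, so its weight is unchanged.
  have hfix : ∀ (ν : Step Act Out X →₀ S) (y : Step Act Out X) (z : Step Act Out X'),
      (∀ x : Step Act Out X, x.map h = z ↔ x = y) → ν.mapDomain (Step.map h) z = ν y := by
    intro ν y z hyz
    rw [mapDomain_apply_eq_weight, weight]
    simp only [Set.mem_ofPred_eq, hyz]
    rw [Finset.sum_filter, Finset.sum_ite_eq']
    split_ifs with hy
    · rfl
    · exact (Finsupp.notMem_support_iff.1 hy).symm
  refine ⟨fun x α => ?_, fun x α => ?_, fun x α v => ?_, fun x α p y => ?_⟩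
  · rw [← hh]; exact hfix _ _ _ fun x => by cases x <;> simp [Step.map]
  · rw [← hh]; exact hfix _ _ _ fun x => by cases x <;> simp [Step.map]
  · rw [← hh]; exact hfix _ _ _ fun x => by cases x <;> simp [Step.map]
  · rw [← hh, mapDomain_apply_eq_weight]
    congr 1
    ext z
    cases z <;> simp [Step.map]
    grind

end Coupling

/-! ### From behavioural equivalence to bisimulation -/

section Bisimulation

variable {Act Out X : Type*}

/-- Steps that agree up to `R` arise from a step between related pairs. -/
lemma exists_step_of_map_eq {R : Setoid X} {x y : Step Act Out X}
    (h : x.map (Quotient.mk R) = y.map (Quotient.mk R)) :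
    ∃ z : Step Act Out {z : X × X | R z.1 z.2},
      z.map (fun z => z.1.1) = x ∧ z.map (fun z => z.1.2) = y := by
  cases x <;> cases y <;> simp only [Step.map, Step.act.injEq, Step.out.injEq, reduceCtorEq] at h
  · exact ⟨.accept, rfl, rfl⟩
  · exact ⟨.reject, rfl, rfl⟩
  · subst h; exact ⟨.out _, rfl, rfl⟩
  · obtain ⟨rfl, h⟩ := h
    exact ⟨.act _ ⟨(_, _), Quotient.exact h⟩, rfl, rfl⟩

variable {T S : Type*} [ConwaySemiring S]

lemma isBisimulation_beh (hpos : IsPositive S) (href : IsRefinement S) :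
    IsBisimulation (deriv (T := T) (Act := Act) (Out := Out) (S := S)) deriv
      {z | beh z.1 z.2} := by
  have key : ∀ (z : {z : Exp T Act Out S × Exp T Act Out S | beh z.1 z.2}) (α : At T),
      ∃ ρ : Step Act Out {z : Exp T Act Out S × Exp T Act Out S | beh z.1 z.2} →₀ S,
        ρ.mapDomain (Step.map fun z => z.1.1) = deriv z.1.1 α ∧
        ρ.mapDomain (Step.map fun z => z.1.2) = deriv z.1.2 α := by
    intro z α
    obtain ⟨ρ, h₁, h₂⟩ := href.exists_coupling hpos _ _ (beh_iff.1 z.2 α)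
    -- The coupling lives on pairs of steps; `k` turns each into one step whose successor is a pair
    -- of related states.
    choose k hk₁ hk₂ using fun w : {w : Step Act Out (Exp T Act Out S) × Step Act Out _ //
      w.1.map (Quotient.mk beh) = w.2.map (Quotient.mk beh)} => exists_step_of_map_eq w.2
    refine ⟨ρ.mapDomain k, ?_, ?_⟩
    · rw [← Finsupp.mapDomain_comp, ← h₁]
      exact congrArg (fun g => ρ.mapDomain g) (funext hk₁)
    · rw [← Finsupp.mapDomain_comp, ← h₂]
      exact congrArg (fun g => ρ.mapDomain g) (funext hk₂)
  choose ρ h₁ h₂ using key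
  exact ⟨ρ, isHom_of_mapDomain h₁, isHom_of_mapDomain h₂⟩

end Bisimulation

end WGKAT

theorem mainTheorem3 {T Act Out S : Type*} [Finite T] [WGKAT.ConwaySemiring S] [Nontrivial S]
    (hpos : WGKAT.IsPositive S) (href : WGKAT.IsRefinement S)
    (e f : WGKAT.Exp T Act Out S) (h : WGKAT.DotEquiv e f) : WGKAT.Exp.Bisim e f := by
  exact ⟨_, WGKAT.isBisimulation_beh hpos href, WGKAT.beh_of_dotEquiv h⟩
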